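/- Let $d\ge 1$ (in particular $d=2$), let $(\Omega,\mathcal A,\mathbb P)$ be a probability space with a measurable flow $(\theta_x)_{x\in\mathbb R^d}$ ($\theta_0=\mathrm{id}$, $\theta_x\circ\theta_y=\theta_{x+y}$, $(x,\omega)\mapsto\theta_x\omega$ measurable) that preserves $\mathbb P$. Let $\Phi$ be a simple, locally finite point process on $\mathbb R^d$ with atoms $\{T_n\}$ and finite intensity $\lambda=\mathbb E[\Phi([0,1)^d)]$, compatible with the flow: $\Phi(\omega,B+x)=\Phi(\theta_x\omega,B)$. Its Palm probability is $$\mathbb P^o(A)=\frac1\lambda\,\mathbb E\Big[\sum_{T_n\in\Phi\cap[0,1)^d}\mathbf 1_A\circ\theta_{T_n}\Big];$$ under $\mathbb P^o$ there is almost surely an atom at the origin, and this typical atom is denoted $T_0=0$. Let $\{m_n(y)\}\subset[0,\infty]$, $y\in\mathbb R^d$, be measurable fields attached to the atoms with $m_0(y)\circ\theta_{T_n}=m_n(y+T_n)$, where on the left $m_0$ is the field of the atom at the origin. Assume that for every $y$ there is almost surely exactly one atom $\kappa(y)$ whose field at $y$ is strictly larger than that of every other atom (so $\kappa(y)=T_n$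 for $n=\arg\sup_n m_n(y)$), and let $\mathcal C(T_n)=\{y\in\mathbb R^d:\kappa(y)=T_n\}$ be the association cell of $T_n$ and $|\mathcal C(T_n)|$ its Lebesgue measure. Let $J(T_n)\in\{1,\dots,K\}$ be measurable tier marks, $J(T_n)=J(T_0)\circ\theta_{T_n}$ (with the same convention; independence of the marks is not needed), and let $\mathbb E^{o,i}$ be the expectation under $\mathbb P^o(\,\cdot\mid J(T_0)=i)$. Let $i$ be a tier with $\mathbb P(J(\kappa(0))=i)>0$. Then $\mathbb P^o(J(T_0)=i)>0$ and $0<\mathbb E^{o,i}[|\mathcal C(T_0)|]<\infty$, and for every measurable $g:\Omega\to[0,\infty]$ $$\mathbb E[g\mid J(\kappa(0))=i]=\frac{\mathbb E^{o,i}\Big[\int_{\mathcal C(T_0)}g\circ\theta_u\,\mathrm du\Big]}{\mathbb E^{o,i}\big[|\mathcal C(T_0)|\big]}.$$ -/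

import Mathlib

open MeasureTheory ProbabilityTheory Set
open scoped ENNReal

/-- The Euclidean space `ℝ^d`. -/
abbrev Space (d : ℕ) : Type := EuclideanSpace ℝ (Fin d)

/-- The half-open unit cube `[0,1)^d`. -/
def unitCube (d : ℕ) : Set (Space d) := {x | ∀ j, x j ∈ Ico (0 : ℝ) 1}

section StationaryFramework

variable {d : ℕ} {Ω : Type*} [MeasurableSpace Ω] [AddAction (Space d) Ω]

/-- A simple, locally finite point process on `ℝ^d`, given by its random set of atoms, that is
compatible with the flow `θ_x ω = x +ᵥ ω`: `Φ(ω, B + x) = Φ(θ_x ω, B)`. -/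
structure IsCompatiblePointProcess (Φ : Ω → Set (Space d)) : Prop where
  locallyFinite : ∀ ω B, Bornology.IsBounded B → (Φ ω ∩ B).Finite
  measurable_count : ∀ B, MeasurableSet B → Measurable fun ω => (Φ ω ∩ B).encard
  compatible : ∀ ω x B, MeasurableSet B →
    (Φ ω ∩ ((fun y => y + x) '' B)).encard = (Φ (x +ᵥ ω) ∩ B).encard

/-- The intensity `λ = E[Φ([0,1)^d)]`. -/
noncomputable def intensity (P : Measure Ω) (Φ : Ω → Set (Space d)) : ℝ≥0∞ :=
  ∫⁻ ω, ((Φ ω ∩ unitCube d).encard : ℝ≥0∞) ∂P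

/-- The Palm probability `P^o(A) = λ⁻¹ E[∑_{x ∈ Φ ∩ [0,1)^d} 1_A ∘ θ_x]`
(see `palm_apply`). Under it there is almost surely an atom at the origin, which is the typical
atom `T_0 = 0`. -/
noncomputable def palm (P : Measure Ω) (Φ : Ω → Set (Space d)) : Measure Ω :=
  (intensity P Φ)⁻¹ •
    P.bind fun ω => (Measure.count.restrict (Φ ω ∩ unitCube d)).map fun x => x +ᵥ ω

/-- Fields `m_n(y) ∈ [0,∞]` attached to the atoms of `Φ`: `m ω x y` is the value at the location
`y` of the field of the atom `x ∈ Φ ω` (values for `x ∉ Φ ω` are irrelevant). The condition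
`mark` is `m_0(y) ∘ θ_{T_n} = m_n(y + T_n)`; in `θ_{T_n} ω` the atom `T_n` has become the atom at
the origin. -/
structure IsMarkField (Φ : Ω → Set (Space d)) (m : Ω → Space d → Space d → ℝ≥0∞) : Prop where
  measurable : Measurable fun q : Ω × Space d × Space d => m q.1 q.2.1 q.2.2
  mark : ∀ ω, ∀ x ∈ Φ ω, ∀ y, m (x +ᵥ ω) 0 y = m ω x (y + x)

/-- Tier indices `J(T_n) ∈ {1, …, K}` that are marks of `Φ`: `J(T_n) = J(T_0) ∘ θ_{T_n}`. -/
structure IsTierMark {K : ℕ} (Φ : Ω → Set (Space d)) (J : Ω → Space d → Fin K) : Prop where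
  measurable : Measurable fun q : Ω × Space d => J q.1 q.2
  mark : ∀ ω, ∀ x ∈ Φ ω, J (x +ᵥ ω) 0 = J ω x

end StationaryFramework

section Association

variable {d : ℕ} {Ω : Type*}

/-- `κ(y) = x`, that is, the atom `x` is the (unique) `arg sup` of `m_n(y)` over the atoms. -/
def IsServing (Φ : Ω → Set (Space d)) (m : Ω → Space d → Space d → ℝ≥0∞)
    (ω : Ω) (y x : Space d) : Prop :=
  x ∈ Φ ω ∧ ∀ x' ∈ Φ ω, x' ≠ x → m ω x' y < m ω x y

/-- The association cell `C(x) = {y | κ(y) = x}`. -/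
def cell (Φ : Ω → Set (Space d)) (m : Ω → Space d → Space d → ℝ≥0∞)
    (ω : Ω) (x : Space d) : Set (Space d) :=
  {y | IsServing Φ m ω y x}

/-- The event `J(κ(0)) = i` that the origin is served by an atom of tier `i`. -/
def servedByTier {K : ℕ} (Φ : Ω → Set (Space d)) (m : Ω → Space d → Space d → ℝ≥0∞)
    (J : Ω → Space d → Fin K) (i : Fin K) : Set Ω :=
  {ω | ∃ x, IsServing Φ m ω 0 x ∧ J ω x = i}

/-- The event `J(T_0) = i`, with `T_0 = 0` the typical atom (used under the Palm probability). -/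
def typicalTier {K : ℕ} (J : Ω → Space d → Fin K) (i : Fin K) : Set Ω :=
  {ω | J ω 0 = i}

end Association

section PalmFormula

variable {d : ℕ} {Ω : Type*} [MeasurableSpace Ω] [AddAction (Space d) Ω]

theorem measurableSet_unitCube (d : ℕ) : MeasurableSet (unitCube d) := by
  have h : unitCube d = ⋂ j : Fin d, (fun x : Space d => x j) ⁻¹' Ico (0 : ℝ) 1 := by
    ext x; simp [unitCube]
  rw [h]
  refine MeasurableSet.iInter fun j => ?_
  have : Measurable fun x : Space d => x j := by fun_prop
  exact this measurableSet_Ico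

theorem isBounded_unitCube (d : ℕ) : Bornology.IsBounded (unitCube d) := by
  refine (Metric.isBounded_iff_subset_closedBall 0).2 ⟨Real.sqrt d, fun x hx => ?_⟩
  rw [mem_closedBall_zero_iff, EuclideanSpace.norm_eq]
  refine Real.sqrt_le_sqrt ?_
  calc ∑ j, ‖x j‖ ^ 2 ≤ ∑ _j : Fin d, (1 : ℝ) := by
        refine Finset.sum_le_sum fun j _ => ?_
        have h := hx j
        rw [Real.norm_eq_abs, sq_abs]
        nlinarith [h.1, h.2]
    _ = d := by simp

/-- The defining measure of `palm` is the intended one. -/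
theorem palm_apply [MeasurableVAdd₂ (Space d) Ω] (P : Measure Ω) {Φ : Ω → Set (Space d)}
    (hΦ : IsCompatiblePointProcess Φ) {A : Set Ω} (hA : MeasurableSet A) :
    palm P Φ A = (intensity P Φ)⁻¹ *
      ∫⁻ ω, ((Φ ω ∩ unitCube d ∩ {x | x +ᵥ ω ∈ A}).encard : ℝ≥0∞) ∂P := by
  have hfin : ∀ ω, (Φ ω ∩ unitCube d).Finite := fun ω =>
    hΦ.locallyFinite ω _ (isBounded_unitCube d)
  have hN : Measurable fun ω => (Measure.count.restrict (Φ ω ∩ unitCube d) : Measure (Space d)) := by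
    refine Measure.measurable_of_measurable_coe _ fun B hB => ?_
    have h := hΦ.measurable_count _ ((measurableSet_unitCube d).inter hB)
    have h2 : (fun ω => Measure.count.restrict (Φ ω ∩ unitCube d) B) =
        fun ω => (((Φ ω ∩ (unitCube d ∩ B)).encard : ℕ∞) : ℝ≥0∞) := by
      funext ω
      rw [Measure.restrict_apply hB, Measure.count_apply
        (hB.inter (hfin ω).measurableSet)]
      congr 2
      ext; simp; tauto
    rw [h2]
    exact (measurable_of_countable _).comp h
  have hval : ∀ ω S, MeasurableSet S →
      (Measure.count.restrict (Φ ω ∩ unitCube d)).map (fun x => x +ᵥ ω) S =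
      ((Φ ω ∩ unitCube d ∩ {x | x +ᵥ ω ∈ S}).encard : ℝ≥0∞) := by
    intro ω S hS
    have hm : Measurable fun x : Space d => x +ᵥ ω := by fun_prop
    rw [Measure.map_apply hm hS, Measure.restrict_apply (hm hS), Measure.count_apply
      ((hm hS).inter (hfin ω).measurableSet), inter_comm]
    rfl
  let κ : Kernel Ω (Space d) := ⟨_, hN⟩
  have hker : Measurable fun ω =>
      (Measure.count.restrict (Φ ω ∩ unitCube d)).map fun x : Space d => x +ᵥ ω := by
    refine Measure.measurable_of_measurable_coe _ fun S hS => ?_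
    have hT : MeasurableSet {q : Ω × Space d | q.2 +ᵥ q.1 ∈ S} := by
      have : Measurable fun q : Ω × Space d => q.2 +ᵥ q.1 := by fun_prop
      exact this hS
    have hκ : ∀ ω, IsFiniteMeasure (κ ω) := fun ω => ⟨by
      change Measure.count.restrict (Φ ω ∩ unitCube d) univ < ∞
      rw [Measure.restrict_apply_univ]
      exact Measure.count_apply_lt_top.2 (hfin ω)⟩
    have := Kernel.measurable_kernel_prodMk_left_of_finite (κ := κ) hT hκ
    convert this using 2 with ω
    have hm : Measurable fun x : Space d => x +ᵥ ω := by fun_prop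
    rw [Measure.map_apply hm hS]
    rfl
  rw [palm, Measure.smul_apply, Measure.bind_apply hA hker.aemeasurable, smul_eq_mul]
  congr 1
  exact lintegral_congr fun ω => hval ω A hA

end PalmFormula

/-! The proof is a mass transport argument. Let every location `v` served by a tier-`i` atom `x`
send mass `g (v +ᵥ ω)` to `x`. The expected mass received by the atoms in the unit cube can be
computed in two ways. Recentring at each receiving atom turns it into `λ` times the Palm integral of
`∫_{C(T_0)} g ∘ θ_u du` over `J(T_0) = i`. Moving each `v` to the origin by stationarity leaves only
the atom serving the origin, weighted by the volume of the translates `v` that put it in the cube.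
That volume is 1, so the total is the integral of `g` over the event `J(κ(0)) = i`. This identity is
`setLIntegral_typicalTier_palm`, resting on `lintegral_servedWeight_unitCube`. Dividing its instance
for `g` by the one for `g = 1` cancels `λ` and both conditioning constants. -/

/-- A kernel whose measures are all finite is s-finite, even without a uniform bound. -/
theorem isSFiniteKernel_of_forall_isFiniteMeasure {α β : Type*} [MeasurableSpace α]
    [MeasurableSpace β] (κ : Kernel α β) (hκ : ∀ a, IsFiniteMeasure (κ a)) :
    IsSFiniteKernel κ := by
  have hmass : Measurable fun a => 1 + κ a univ :=
    measurable_const.add (κ.measurable_coe MeasurableSet.univ)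
  have hne : ∀ a, 1 + κ a univ ≠ ∞ := fun a =>
    ENNReal.add_ne_top.2 ⟨ENNReal.one_ne_top, measure_ne_top _ _⟩
  have hpos : ∀ a, 1 + κ a univ ≠ 0 := fun a => by simp
  -- Dividing by one plus the mass bounds every total mass by 1; a finite density then restores `κ`.
  let η : Kernel α β := ⟨fun a => (1 + κ a univ)⁻¹ • κ a, by
    refine Measure.measurable_of_measurable_coe _ fun s hs => ?_
    simp only [Measure.smul_apply, smul_eq_mul]
    exact hmass.inv.mul (κ.measurable_coe hs)⟩
  have hη : ∀ a, η a = (1 + κ a univ)⁻¹ • κ a := fun _ => rfl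
  have : IsFiniteKernel η := ⟨1, ENNReal.one_lt_top, fun a => by
    rw [hη, Measure.smul_apply, smul_eq_mul, mul_comm, ← div_eq_mul_inv]
    exact ENNReal.div_le_of_le_mul (by rw [one_mul]; exact le_add_self)⟩
  have hf : Measurable (Function.uncurry fun (a : α) (_ : β) => 1 + κ a univ) :=
    hmass.comp measurable_fst
  have heq : η.withDensity (fun a _ => 1 + κ a univ) = κ := by
    ext a : 1
    rw [Kernel.withDensity_apply _ hf, withDensity_const, hη, smul_smul,
      ENNReal.mul_inv_cancel (hpos a) (hne a), one_smul]
  rw [← heq]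
  exact Kernel.IsSFiniteKernel.withDensity η fun a _ => hne a

/-! ### The counting kernel of the atoms and Campbell's formula for the Palm measure. -/

section StationaryPointProcess

variable {d : ℕ} {Ω : Type*} [MeasurableSpace Ω] [AddAction (Space d) Ω]
  {Φ : Ω → Set (Space d)}

namespace IsCompatiblePointProcess

/-- Compatibility of counts, tested on singletons, determines the atoms themselves. -/
theorem mem_vadd_iff (hΦ : IsCompatiblePointProcess Φ) (ω : Ω) (z x : Space d) :
    x ∈ Φ (z +ᵥ ω) ↔ x + z ∈ Φ ω := by
  have h := hΦ.compatible ω z {x} (measurableSet_singleton x)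
  rw [image_singleton] at h
  have key : ∀ (A : Set (Space d)) (a : Space d), a ∈ A ↔ (A ∩ {a}).encard ≠ 0 := by
    intro A a
    rw [encard_ne_zero, inter_singleton_nonempty]
  rw [key, key (Φ ω), h]

theorem countable (hΦ : IsCompatiblePointProcess Φ) (ω : Ω) : (Φ ω).Countable := by
  have h : Φ ω = ⋃ n : ℕ, Φ ω ∩ Metric.closedBall 0 n := by
    rw [← inter_iUnion, Metric.iUnion_closedBall_nat, inter_univ]
  rw [h]
  exact countable_iUnion fun n => (hΦ.locallyFinite ω _ Metric.isBounded_closedBall).countable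

/-- The random counting measure of the atoms of `Φ` in `B`. -/
noncomputable def atomsIn (hΦ : IsCompatiblePointProcess Φ) (B : Set (Space d))
    (hB : MeasurableSet B) : Kernel Ω (Space d) :=
  ⟨fun ω => Measure.count.restrict (Φ ω ∩ B), by
    refine Measure.measurable_of_measurable_coe _ fun A hA => ?_
    have h : (fun ω => Measure.count.restrict (Φ ω ∩ B) A) =
        fun ω => (((Φ ω ∩ (B ∩ A)).encard : ℕ∞) : ℝ≥0∞) := by
      funext ω
      rw [Measure.restrict_apply hA, Measure.count_apply
        (hA.inter ((hΦ.countable ω).measurableSet.inter hB)), inter_comm, inter_assoc]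
    rw [h]
    exact (measurable_of_countable _).comp (hΦ.measurable_count _ (hB.inter hA))⟩

/-- The random counting measure of the atoms of `Φ`. -/
noncomputable def atoms (hΦ : IsCompatiblePointProcess Φ) : Kernel Ω (Space d) :=
  hΦ.atomsIn univ MeasurableSet.univ

theorem atoms_apply (hΦ : IsCompatiblePointProcess Φ) (ω : Ω) :
    hΦ.atoms ω = Measure.count.restrict (Φ ω) := by
  change Measure.count.restrict (Φ ω ∩ univ) = _
  rw [inter_univ]

/-- Cut space into the shells `⌊‖x‖⌋₊ = n`: each holds finitely many atoms, though with no bound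
uniform in `ω`. S-finiteness gives Tonelli and measurability of integrals against the atoms. -/
instance (hΦ : IsCompatiblePointProcess Φ) : IsSFiniteKernel hΦ.atoms := by
  have hmeas : ∀ n : ℕ, MeasurableSet {x : Space d | ⌊‖x‖⌋₊ = n} := fun n =>
    (Nat.measurable_floor.comp measurable_norm) (measurableSet_singleton n)
  have hsum : hΦ.atoms = Kernel.sum fun n : ℕ => hΦ.atomsIn {x | ⌊‖x‖⌋₊ = n} (hmeas n) := by
    ext ω : 1
    rw [Kernel.sum_apply, hΦ.atoms_apply]
    change _ = Measure.sum fun n : ℕ => Measure.count.restrict (Φ ω ∩ {x | ⌊‖x‖⌋₊ = n})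
    rw [← Measure.restrict_iUnion]
    · congr 1
      ext x
      simp
    · intro a b hab
      refine disjoint_left.2 fun x hxa hxb => hab ?_
      rw [← hxa.2, ← hxb.2]
    · exact fun n => (hΦ.countable ω).measurableSet.inter (hmeas n)
  rw [hsum]
  have : ∀ n : ℕ, IsSFiniteKernel (hΦ.atomsIn {x | ⌊‖x‖⌋₊ = n} (hmeas n)) := fun n => by
    refine isSFiniteKernel_of_forall_isFiniteMeasure _ fun ω => ⟨?_⟩
    change Measure.count.restrict (Φ ω ∩ {x | ⌊‖x‖⌋₊ = n}) univ < ∞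
    rw [Measure.restrict_apply_univ]
    refine Measure.count_apply_lt_top.2 (hΦ.locallyFinite ω _ ?_)
    refine (Metric.isBounded_closedBall (x := (0 : Space d)) (r := n + 1)).subset fun x hx => ?_
    rw [mem_closedBall_zero_iff, ← show ⌊‖x‖⌋₊ = n from hx]
    exact (Nat.lt_floor_add_one _).le
  exact Kernel.isSFiniteKernel_sum

theorem atoms_eq_zero_iff (hΦ : IsCompatiblePointProcess Φ) (ω : Ω) {A : Set (Space d)}
    (hA : MeasurableSet A) : hΦ.atoms ω A = 0 ↔ ∀ x ∈ Φ ω, x ∉ A := by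
  rw [hΦ.atoms_apply, Measure.restrict_apply hA, Measure.count_eq_zero_iff]
  exact ⟨fun h x hx hxA => (h ▸ (⟨hxA, hx⟩ : x ∈ A ∩ Φ ω) : x ∈ (∅ : Set (Space d))),
    fun h => eq_empty_of_forall_notMem fun x hx => h x hx.2 hx.1⟩

theorem atoms_eq_map_add (hΦ : IsCompatiblePointProcess Φ) (ω : Ω) (z : Space d) :
    hΦ.atoms ω = (hΦ.atoms (z +ᵥ ω)).map fun x => x + z := by
  have hm : Measurable fun x : Space d => x + z := by fun_prop
  ext A hA
  rw [Measure.map_apply hm hA, hΦ.atoms_apply, hΦ.atoms_apply, Measure.restrict_apply hA,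
    Measure.restrict_apply (hm hA)]
  rw [Measure.count_apply (hA.inter (hΦ.countable ω).measurableSet),
    Measure.count_apply ((hm hA).inter (hΦ.countable _).measurableSet)]
  have : A ∩ Φ ω = (fun x => x + z) '' ((fun x => x + z) ⁻¹' A ∩ Φ (z +ᵥ ω)) := by
    ext x
    simp only [mem_inter_iff, mem_image, mem_preimage, hΦ.mem_vadd_iff]
    constructor
    · rintro ⟨h1, h2⟩
      exact ⟨x - z, by simpa using ⟨h1, h2⟩, by simp⟩
    · rintro ⟨y, hy, rfl⟩
      exact hy
  rw [this, (add_left_injective z).encard_image]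

/-- The flow reduces joint measurability to the single event that the origin is an atom. -/
theorem measurableSet_mem [MeasurableVAdd₂ (Space d) Ω] (hΦ : IsCompatiblePointProcess Φ) :
    MeasurableSet {q : Ω × Space d | q.2 ∈ Φ q.1} := by
  have h0 : MeasurableSet {ω | (0 : Space d) ∈ Φ ω} := by
    have h : {ω | (0 : Space d) ∈ Φ ω} = {ω | hΦ.atoms ω {0} = 0}ᶜ := by
      ext ω
      simp [hΦ.atoms_eq_zero_iff ω (measurableSet_singleton 0)]
    rw [h]
    exact (hΦ.atoms.measurable_coe (measurableSet_singleton 0) (measurableSet_singleton 0)).compl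
  have h : {q : Ω × Space d | q.2 ∈ Φ q.1} =
      (fun q : Ω × Space d => q.2 +ᵥ q.1) ⁻¹' {ω | (0 : Space d) ∈ Φ ω} := by
    ext q
    simp [hΦ.mem_vadd_iff]
  rw [h]
  exact (by fun_prop : Measurable fun q : Ω × Space d => q.2 +ᵥ q.1) h0

theorem lintegral_palm [MeasurableVAdd₂ (Space d) Ω] (hΦ : IsCompatiblePointProcess Φ)
    (P : Measure Ω) {H : Ω → ℝ≥0∞} (hH : Measurable H) :
    ∫⁻ ω, H ω ∂(palm P Φ) =
      (intensity P Φ)⁻¹ * ∫⁻ ω, ∫⁻ x in unitCube d, H (x +ᵥ ω) ∂(hΦ.atoms ω) ∂P := by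
  have hm : ∀ ω : Ω, Measurable fun x : Space d => x +ᵥ ω := fun ω => by fun_prop
  have hres : ∀ ω, Measure.count.restrict (Φ ω ∩ unitCube d) =
      (hΦ.atoms ω).restrict (unitCube d) := fun ω => by
    rw [hΦ.atoms_apply, Measure.restrict_restrict (measurableSet_unitCube d), inter_comm]
  have hker : Measurable fun ω =>
      (Measure.count.restrict (Φ ω ∩ unitCube d)).map fun x : Space d => x +ᵥ ω := by
    refine Measure.measurable_of_measurable_coe _ fun S hS => ?_
    have h : ∀ ω, (Measure.count.restrict (Φ ω ∩ unitCube d)).map (fun x => x +ᵥ ω) S =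
        hΦ.atoms ω (Prod.mk ω ⁻¹' {q : Ω × Space d | q.2 +ᵥ q.1 ∈ S ∧ q.2 ∈ unitCube d}) := by
      intro ω
      rw [Measure.map_apply (hm ω) hS, hres, Measure.restrict_apply (hm ω hS)]
      rfl
    simp_rw [h]
    refine Kernel.measurable_kernel_prodMk_left (MeasurableSet.inter ?_ ?_)
    · exact (by fun_prop : Measurable fun q : Ω × Space d => q.2 +ᵥ q.1) hS
    · exact measurable_snd (measurableSet_unitCube d)
  rw [palm, lintegral_smul_measure, smul_eq_mul,
    Measure.lintegral_bind hker.aemeasurable hH.aemeasurable]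
  congr 1
  refine lintegral_congr fun ω => ?_
  rw [lintegral_map hH (hm ω), hres]

end IsCompatiblePointProcess

end StationaryPointProcess


theorem volume_unitCube (d : ℕ) : volume (unitCube d) = 1 := by
  have h : unitCube d = (MeasurableEquiv.toLp 2 (Fin d → ℝ)).symm ⁻¹'
      (univ.pi fun _ => Ico (0 : ℝ) 1) := by
    ext x; simp [unitCube]
  rw [h, (EuclideanSpace.volume_preserving_symm_measurableEquiv_toLp (Fin d)).measure_preimage
    (MeasurableSet.univ_pi fun _ => measurableSet_Ico).nullMeasurableSet, Real.volume_pi_Ico]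
  simp

/-! ### Equivariance and measurability of the association, and the mass transport identity. -/

section Association

variable {d K : ℕ} {Ω : Type*} [MeasurableSpace Ω] [AddAction (Space d) Ω]
  {Φ : Ω → Set (Space d)} {m : Ω → Space d → Space d → ℝ≥0∞} {J : Ω → Space d → Fin K}

theorem IsServing.unique {Ω : Type*} {Φ : Ω → Set (Space d)}
    {m : Ω → Space d → Space d → ℝ≥0∞} {ω : Ω} {y x x' : Space d} (h : IsServing Φ m ω y x)
    (h' : IsServing Φ m ω y x') : x' = x := by
  by_contra hne
  exact lt_asymm (h.2 x' h'.1 hne) (h'.2 x h.1 (Ne.symm hne))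

/-- The mark condition only concerns fields seen from their own atom, so both sides are compared
after recentring at that atom. -/
theorem IsMarkField.vadd (hΦ : IsCompatiblePointProcess Φ) (hm : IsMarkField Φ m) (ω : Ω)
    (z y : Space d) {x : Space d} (hx : x ∈ Φ (z +ᵥ ω)) :
    m (z +ᵥ ω) x y = m ω (x + z) (y + z) := by
  have h1 := hm.mark (z +ᵥ ω) x hx (y - x)
  have h2 := hm.mark ω (x + z) ((hΦ.mem_vadd_iff ω z x).1 hx) (y - x)
  rw [vadd_vadd, sub_add_cancel] at h1
  rw [← h1, h2]
  congr 1
  abel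

theorem IsTierMark.vadd (hΦ : IsCompatiblePointProcess Φ) (hJ : IsTierMark Φ J) (ω : Ω)
    (z : Space d) {x : Space d} (hx : x ∈ Φ (z +ᵥ ω)) : J (z +ᵥ ω) x = J ω (x + z) := by
  rw [← hJ.mark (z +ᵥ ω) x hx, vadd_vadd, hJ.mark ω _ ((hΦ.mem_vadd_iff ω z x).1 hx)]

theorem isServing_vadd_iff (hΦ : IsCompatiblePointProcess Φ) (hm : IsMarkField Φ m) (ω : Ω)
    (z y x : Space d) : IsServing Φ m (z +ᵥ ω) y x ↔ IsServing Φ m ω (y + z) (x + z) := by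
  unfold IsServing
  rw [hΦ.mem_vadd_iff]
  refine and_congr_right fun hx => ⟨fun h x' hx' hne => ?_, fun h x' hx' hne => ?_⟩
  · have hx'' : x' - z ∈ Φ (z +ᵥ ω) := by rwa [hΦ.mem_vadd_iff, sub_add_cancel]
    have := h (x' - z) hx'' fun h => hne (by rw [← h, sub_add_cancel])
    rwa [hm.vadd hΦ ω z y hx'', hm.vadd hΦ ω z y ((hΦ.mem_vadd_iff ω z x).2 hx),
      sub_add_cancel] at this
  · rw [hm.vadd hΦ ω z y hx', hm.vadd hΦ ω z y ((hΦ.mem_vadd_iff ω z x).2 hx)]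
    exact h _ ((hΦ.mem_vadd_iff ω z x').1 hx') fun h => hne (add_right_cancel h)

/-- Being undefeated means that the set of competitors at least as strong carries no atoms, a
measurable condition on the counting kernel that needs no enumeration of atoms. -/
theorem measurableSet_isServing [MeasurableVAdd₂ (Space d) Ω]
    (hΦ : IsCompatiblePointProcess Φ) (hm : IsMarkField Φ m) :
    MeasurableSet {q : (Ω × Space d) × Space d | IsServing Φ m q.1.1 q.1.2 q.2} := by
  let B : Set (((Ω × Space d) × Space d) × Space d) :=
    {r | r.2 ≠ r.1.2 ∧ m r.1.1.1 r.1.2 r.1.1.2 ≤ m r.1.1.1 r.2 r.1.1.2}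
  have hB : MeasurableSet B := by
    refine MeasurableSet.inter ?_ ?_
    · exact (measurableSet_eq_fun measurable_snd measurable_fst.snd).compl
    · exact measurableSet_le
        (hm.measurable.comp (measurable_fst.fst.fst.prodMk
          (measurable_fst.snd.prodMk measurable_fst.fst.snd)))
        (hm.measurable.comp (measurable_fst.fst.fst.prodMk
          (measurable_snd.prodMk measurable_fst.fst.snd)))
  let N : Kernel ((Ω × Space d) × Space d) (Space d) :=
    hΦ.atoms.comap (fun q => q.1.1) measurable_fst.fst
  have heq : {q : (Ω × Space d) × Space d | IsServing Φ m q.1.1 q.1.2 q.2} =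
      (fun q : (Ω × Space d) × Space d => (q.1.1, q.2)) ⁻¹' {p | p.2 ∈ Φ p.1} ∩
        {q | N q (Prod.mk q ⁻¹' B) = 0} := by
    ext q
    have h0 : N q (Prod.mk q ⁻¹' B) = 0 ↔ _ :=
      hΦ.atoms_eq_zero_iff q.1.1 (measurable_prodMk_left hB)
    simp only [mem_inter_iff, mem_preimage, mem_ofPred_eq, h0]
    refine and_congr_right fun _ => forall₂_congr fun x' _ => ?_
    simp only [B, mem_ofPred_eq, not_and, not_le]
  rw [heq]
  exact (hΦ.measurableSet_mem.preimage (measurable_fst.fst.prodMk measurable_snd)).inter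
    (Kernel.measurable_kernel_prodMk_left hB (measurableSet_singleton 0))

/-- The weight `g (v +ᵥ ω)` if the location `v` is served by the tier-`i` atom `x`, else `0`. -/
noncomputable def servedWeight (Φ : Ω → Set (Space d)) (m : Ω → Space d → Space d → ℝ≥0∞)
    (J : Ω → Space d → Fin K) (i : Fin K) (g : Ω → ℝ≥0∞) : (Ω × Space d) × Space d → ℝ≥0∞ :=
  indicator {q | IsServing Φ m q.1.1 q.1.2 q.2 ∧ J q.1.1 q.2 = i} fun q => g (q.1.2 +ᵥ q.1.1)

theorem servedWeight_of_isServing {Ω : Type*} [AddAction (Space d) Ω] {Φ : Ω → Set (Space d)}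
    {m : Ω → Space d → Space d → ℝ≥0∞} {J : Ω → Space d → Fin K}
    {i : Fin K} (g : Ω → ℝ≥0∞) {ω : Ω} {v x : Space d}
    (h : IsServing Φ m ω v x ∧ J ω x = i) :
    servedWeight Φ m J i g ((ω, v), x) = g (v +ᵥ ω) :=
  indicator_of_mem
    (s := {q : (Ω × Space d) × Space d | IsServing Φ m q.1.1 q.1.2 q.2 ∧ J q.1.1 q.2 = i}) h _

theorem servedWeight_of_not_isServing {Ω : Type*} [AddAction (Space d) Ω] {Φ : Ω → Set (Space d)}
    {m : Ω → Space d → Space d → ℝ≥0∞} {J : Ω → Space d → Fin K}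
    {i : Fin K} (g : Ω → ℝ≥0∞) {ω : Ω} {v x : Space d}
    (h : ¬ (IsServing Φ m ω v x ∧ J ω x = i)) : servedWeight Φ m J i g ((ω, v), x) = 0 :=
  indicator_of_notMem
    (s := {q : (Ω × Space d) × Space d | IsServing Φ m q.1.1 q.1.2 q.2 ∧ J q.1.1 q.2 = i}) h _

theorem measurable_servedWeight [MeasurableVAdd₂ (Space d) Ω]
    (hΦ : IsCompatiblePointProcess Φ) (hm : IsMarkField Φ m) (hJ : IsTierMark Φ J) (i : Fin K)
    {g : Ω → ℝ≥0∞} (hg : Measurable g) : Measurable (servedWeight Φ m J i g) := by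
  refine Measurable.indicator (hg.comp (by fun_prop)) ((measurableSet_isServing hΦ hm).inter ?_)
  exact (hJ.measurable.comp (measurable_fst.fst.prodMk measurable_snd)) (measurableSet_singleton i)

theorem servedWeight_vadd (hΦ : IsCompatiblePointProcess Φ) (hm : IsMarkField Φ m)
    (hJ : IsTierMark Φ J) (i : Fin K) (g : Ω → ℝ≥0∞) (ω : Ω) (z y x : Space d) :
    servedWeight Φ m J i g ((z +ᵥ ω, y), x) = servedWeight Φ m J i g ((ω, y + z), x + z) := by
  have hiff : (IsServing Φ m (z +ᵥ ω) y x ∧ J (z +ᵥ ω) x = i) ↔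
      (IsServing Φ m ω (y + z) (x + z) ∧ J ω (x + z) = i) := by
    rw [← isServing_vadd_iff hΦ hm]
    exact and_congr_right fun h => by rw [hJ.vadd hΦ ω z h.1]
  by_cases h : IsServing Φ m (z +ᵥ ω) y x ∧ J (z +ᵥ ω) x = i
  · rw [servedWeight_of_isServing g h, servedWeight_of_isServing g (hiff.1 h), vadd_vadd]
  · rw [servedWeight_of_not_isServing g h, servedWeight_of_not_isServing g (mt hiff.2 h)]

/-- At most one atom serves the origin, so the sum has at most one nonzero term. -/
theorem lintegral_servedWeight_atoms (hΦ : IsCompatiblePointProcess Φ) (i : Fin K)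
    (g : Ω → ℝ≥0∞) (ω : Ω) :
    ∫⁻ x, servedWeight Φ m J i g ((ω, 0), x) ∂(hΦ.atoms ω) =
      (servedByTier Φ m J i).indicator g ω := by
  by_cases hω : ω ∈ servedByTier Φ m J i
  · obtain ⟨x, hx, hxi⟩ := id hω
    have h : (fun x' => servedWeight Φ m J i g ((ω, 0), x')) =
        ({x} : Set (Space d)).indicator fun _ => g ω := by
      funext x'
      have hiff : (IsServing Φ m ω 0 x' ∧ J ω x' = i) ↔ x' = x :=
        ⟨fun h => hx.unique h.1, fun h => h ▸ ⟨hx, hxi⟩⟩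
      by_cases h : x' = x
      · rw [servedWeight_of_isServing g (hiff.2 h), indicator_of_mem (mem_singleton_iff.2 h),
          zero_vadd]
      · rw [servedWeight_of_not_isServing g (mt hiff.1 h), indicator_of_notMem (by simpa using h)]
    rw [h, lintegral_indicator_const (measurableSet_singleton x), indicator_of_mem hω,
      hΦ.atoms_apply, Measure.restrict_apply (measurableSet_singleton x),
      inter_eq_left.2 (singleton_subset_iff.2 hx.1), Measure.count_singleton, mul_one]
  · rw [indicator_of_notMem hω]
    have h : ∀ x, servedWeight Φ m J i g ((ω, 0), x) = 0 := fun x =>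
      servedWeight_of_not_isServing g fun h => hω ⟨x, h⟩
    simp [h]

theorem measurableSet_servedByTier [MeasurableVAdd₂ (Space d) Ω]
    (hΦ : IsCompatiblePointProcess Φ) (hm : IsMarkField Φ m) (hJ : IsTierMark Φ J) (i : Fin K) :
    MeasurableSet (servedByTier Φ m J i) := by
  have hmeas : Measurable ((servedByTier Φ m J i).indicator fun _ => (1 : ℝ≥0∞)) := by
    simp_rw [funext fun ω => (lintegral_servedWeight_atoms (m := m) (J := J) hΦ i
      (fun _ => (1 : ℝ≥0∞)) ω).symm]
    exact Measurable.lintegral_kernel_prod_right' (κ := hΦ.atoms)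
      (f := fun q : Ω × Space d => servedWeight Φ m J i (fun _ => 1) ((q.1, 0), q.2))
      ((measurable_servedWeight hΦ hm hJ i measurable_const).comp
        ((measurable_fst.prodMk measurable_const).prodMk measurable_snd))
  have h : servedByTier Φ m J i =
      ((servedByTier Φ m J i).indicator fun _ => (1 : ℝ≥0∞)) ⁻¹' {1} := by
    ext ω
    by_cases hω : ω ∈ servedByTier Φ m J i <;> simp [hω]
  rw [h]
  exact hmeas (measurableSet_singleton 1)

/-- Mass transport between the served origin and the cells of the atoms in the unit cube. -/
theorem lintegral_servedWeight_unitCube [MeasurableVAdd₂ (Space d) Ω] (P : Measure Ω) [SFinite P]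
    [VAddInvariantMeasure (Space d) Ω P] (hΦ : IsCompatiblePointProcess Φ)
    (hm : IsMarkField Φ m) (hJ : IsTierMark Φ J) (i : Fin K) {g : Ω → ℝ≥0∞} (hg : Measurable g) :
    ∫⁻ ω, ∫⁻ x in unitCube d, ∫⁻ v, servedWeight Φ m J i g ((ω, v), x) ∂volume ∂(hΦ.atoms ω) ∂P =
      ∫⁻ ω, (servedByTier Φ m J i).indicator g ω ∂P := by
  have hQ := measurableSet_unitCube d
  have hT := measurable_servedWeight hΦ hm hJ i hg
  set T := servedWeight Φ m J i g
  let N : Kernel (Ω × Space d) (Space d) := hΦ.atoms.comap Prod.fst measurable_fst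
  let χ : Space d → ℝ≥0∞ := (unitCube d).indicator fun _ => 1
  have hχ : Measurable χ := measurable_const.indicator hQ
  -- Every atom is in the cube for a set of translates of volume 1; this removes the cube at the
  -- end.
  have hvol : ∀ z, ∫⁻ v, χ (z + v) = 1 := fun z => by
    rw [lintegral_add_left_eq_self χ z, lintegral_indicator_const hQ, volume_unitCube, one_mul]
  have hF : Measurable fun q : Ω × Space d => ∫⁻ x, χ x * T (q, x) ∂(hΦ.atoms q.1) :=
    Measurable.lintegral_kernel_prod_right' (κ := N)
      (f := fun r => χ r.2 * T r) ((hχ.comp measurable_snd).mul hT)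
  have hT0 : Measurable fun r : (Ω × Space d) × Space d => T ((r.1.1, 0), r.2) :=
    hT.comp ((measurable_fst.fst.prodMk measurable_const).prodMk measurable_snd)
  have hG : Measurable fun q : Ω × Space d =>
      ∫⁻ z, χ (z + q.2) * T ((q.1, 0), z) ∂(hΦ.atoms q.1) :=
    Measurable.lintegral_kernel_prod_right' (κ := N)
      (f := fun r => χ (r.2 + r.1.2) * T ((r.1.1, 0), r.2))
      ((hχ.comp (measurable_snd.add measurable_fst.snd)).mul hT0)
  calc ∫⁻ ω, ∫⁻ x in unitCube d, ∫⁻ v, T ((ω, v), x) ∂volume ∂(hΦ.atoms ω) ∂P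
      = ∫⁻ ω, ∫⁻ v, ∫⁻ x, χ x * T ((ω, v), x) ∂(hΦ.atoms ω) ∂volume ∂P := by
        refine lintegral_congr fun ω => ?_
        have hTω : Measurable fun p : Space d × Space d => T ((ω, p.2), p.1) :=
          hT.comp ((measurable_const.prodMk measurable_snd).prodMk measurable_fst)
        rw [← lintegral_indicator hQ, ← lintegral_lintegral_swap
          ((hχ.comp measurable_fst).mul hTω).aemeasurable]
        refine lintegral_congr fun x => ?_
        by_cases hx : x ∈ unitCube d <;> simp [χ, hx]
    _ = ∫⁻ v, ∫⁻ ω, ∫⁻ x, χ x * T ((ω, v), x) ∂(hΦ.atoms ω) ∂P ∂volume :=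
        lintegral_lintegral_swap hF.aemeasurable
    _ = ∫⁻ v, ∫⁻ ω, ∫⁻ z, χ (z + v) * T ((ω, 0), z) ∂(hΦ.atoms ω) ∂P ∂volume := by
        refine lintegral_congr fun v => ?_
        have hGv : Measurable fun ω => ∫⁻ z, χ (z + v) * T ((ω, 0), z) ∂(hΦ.atoms ω) :=
          hG.comp (measurable_id.prodMk measurable_const)
        -- Stationarity: `ω` becomes `v +ᵥ ω`, whose atoms are those of `ω` shifted by `-v`, so the
        -- location `v` moves to the origin.
        rw [← (measurePreserving_vadd v P).lintegral_comp hGv]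
        refine lintegral_congr fun ω => ?_
        rw [hΦ.atoms_eq_map_add ω v, lintegral_map]
        · refine lintegral_congr fun z => ?_
          rw [show T ((v +ᵥ ω, 0), z) = _ from servedWeight_vadd hΦ hm hJ i g ω v 0 z, zero_add]
        · exact hχ.mul (hT.comp (measurable_const.prodMk measurable_id))
        · fun_prop
    _ = ∫⁻ ω, ∫⁻ v, ∫⁻ z, χ (z + v) * T ((ω, 0), z) ∂(hΦ.atoms ω) ∂volume ∂P :=
        (lintegral_lintegral_swap hG.aemeasurable).symm
    _ = ∫⁻ ω, (servedByTier Φ m J i).indicator g ω ∂P := by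
        refine lintegral_congr fun ω => ?_
        have hTω : Measurable fun z : Space d => T ((ω, 0), z) :=
          hT.comp (measurable_const.prodMk measurable_id)
        rw [lintegral_lintegral_swap ((hχ.comp (measurable_snd.add measurable_fst)).mul
          (hTω.comp measurable_snd)).aemeasurable, ← lintegral_servedWeight_atoms hΦ]
        refine lintegral_congr fun z => ?_
        have hχz : Measurable fun v => χ (z + v) := hχ.comp (by fun_prop)
        rw [lintegral_mul_const _ hχz, hvol, one_mul]

theorem setLIntegral_typicalTier_palm [MeasurableVAdd₂ (Space d) Ω] (P : Measure Ω) [SFinite P]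
    [VAddInvariantMeasure (Space d) Ω P] (hΦ : IsCompatiblePointProcess Φ)
    (hm : IsMarkField Φ m) (hJ : IsTierMark Φ J) (i : Fin K) {g : Ω → ℝ≥0∞} (hg : Measurable g) :
    ∫⁻ ω in typicalTier J i, (∫⁻ u in cell Φ m ω 0, g (u +ᵥ ω)) ∂(palm P Φ) =
      (intensity P Φ)⁻¹ * ∫⁻ ω in servedByTier Φ m J i, g ω ∂P := by
  have hT := measurable_servedWeight hΦ hm hJ i hg
  have hH : Measurable fun ω => ∫⁻ u, servedWeight Φ m J i g ((ω, u), 0) :=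
    Measurable.lintegral_prod_right' (f := fun q => servedWeight Φ m J i g (q, 0))
      (hT.comp (measurable_id.prodMk measurable_const))
  have hcell : ∀ ω, MeasurableSet (cell Φ m ω 0) := fun ω =>
    (measurableSet_isServing hΦ hm).preimage
      ((measurable_const.prodMk measurable_id).prodMk measurable_const :
        Measurable fun y : Space d => ((ω, y), (0 : Space d)))
  have htyp : MeasurableSet (typicalTier J i) :=
    (hJ.measurable.comp (measurable_id.prodMk measurable_const)) (measurableSet_singleton i)
  rw [← lintegral_indicator htyp, ← lintegral_indicator (measurableSet_servedByTier hΦ hm hJ i),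
    ← lintegral_servedWeight_unitCube P hΦ hm hJ i hg]
  have h : ((typicalTier J i).indicator fun ω => ∫⁻ u in cell Φ m ω 0, g (u +ᵥ ω)) =
      fun ω => ∫⁻ u, servedWeight Φ m J i g ((ω, u), 0) := by
    funext ω
    by_cases hω : ω ∈ typicalTier J i
    · rw [indicator_of_mem hω, ← lintegral_indicator (hcell ω)]
      refine lintegral_congr fun u => ?_
      have hiff : (IsServing Φ m ω u 0 ∧ J ω 0 = i) ↔ u ∈ cell Φ m ω 0 :=
        and_iff_left hω
      by_cases h : u ∈ cell Φ m ω 0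
      · rw [indicator_of_mem h, servedWeight_of_isServing g (hiff.2 h)]
      · rw [indicator_of_notMem h, servedWeight_of_not_isServing g (mt hiff.1 h)]
    · rw [indicator_of_notMem hω]
      have h0 : ∀ u, servedWeight Φ m J i g ((ω, u), 0) = 0 := fun u =>
        servedWeight_of_not_isServing g fun h => hω h.2
      simp [h0]
  rw [h, hΦ.lintegral_palm P hH]
  congr 1
  refine lintegral_congr fun ω => lintegral_congr fun x => ?_
  -- The cell of the origin in `x +ᵥ ω` is the cell of `x` shifted by `-x`; translation invariance
  -- of Lebesgue measure absorbs the shift.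
  rw [← lintegral_add_right_eq_self (fun v => servedWeight Φ m J i g ((ω, v), x)) x]
  refine lintegral_congr fun u => ?_
  rw [servedWeight_vadd hΦ hm hJ, zero_add]

end Association

/-! ### Normalising constants and the conditional formula. -/

theorem intensity_ne_zero_of_palm_ne_zero {d : ℕ} {Ω : Type*} [MeasurableSpace Ω]
    [AddAction (Space d) Ω] [MeasurableVAdd₂ (Space d) Ω] (P : Measure Ω)
    {Φ : Ω → Set (Space d)} (hΦ : IsCompatiblePointProcess Φ) (h : palm P Φ univ ≠ 0) :
    intensity P Φ ≠ 0 := by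
  intro h0
  refine h ?_
  rw [palm_apply P hΦ MeasurableSet.univ]
  simp only [mem_univ, ofPred_true, inter_univ]
  -- For zero intensity the inverse is `∞`, but `∞ * 0 = 0`, so the Palm measure vanishes.
  change _ * intensity P Φ = 0
  rw [h0, mul_zero]

theorem palm_univ_le_one {d : ℕ} {Ω : Type*} [MeasurableSpace Ω]
    [AddAction (Space d) Ω] [MeasurableVAdd₂ (Space d) Ω] (P : Measure Ω)
    {Φ : Ω → Set (Space d)} (hΦ : IsCompatiblePointProcess Φ) : palm P Φ univ ≤ 1 := by
  rw [palm_apply P hΦ MeasurableSet.univ]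
  simp only [mem_univ, ofPred_true, inter_univ]
  exact ENNReal.inv_mul_le_one _

/-- In a stationary `K`-tier network, for every tier `i` that serves the origin with positive
probability and every measurable `g ≥ 0`,
`E[g | J(κ(0)) = i] = E^{o,i}[∫_{C(T_0)} g ∘ θ_u du] / E^{o,i}[|C(T_0)|]`,
where `E^{o,i}` is the expectation under `P^o(· | J(T_0) = i)`; the right-hand side is well
defined: `P^o(J(T_0) = i) > 0` and `0 < E^{o,i}[|C(T_0)|] < ∞`. -/
theorem proposition3 {d K : ℕ} {Ω : Type*} [MeasurableSpace Ω]
    [AddAction (Space d) Ω] [MeasurableVAdd₂ (Space d) Ω]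
    (P : Measure Ω) [IsProbabilityMeasure P] [VAddInvariantMeasure (Space d) Ω P]
    (Φ : Ω → Set (Space d)) (hΦ : IsCompatiblePointProcess Φ) (hfin : intensity P Φ ≠ ∞)
    (m : Ω → Space d → Space d → ℝ≥0∞) (hm : IsMarkField Φ m)
    (hargsup : ∀ y, ∀ᵐ ω ∂P, ∃ x, IsServing Φ m ω y x)
    (J : Ω → Space d → Fin K) (hJ : IsTierMark Φ J)
    (i : Fin K) (hi : P (servedByTier Φ m J i) ≠ 0) :
    palm P Φ (typicalTier J i) ≠ 0 ∧
    ∫⁻ ω, volume (cell Φ m ω 0) ∂(palm P Φ)[|typicalTier J i] ≠ 0 ∧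
    ∫⁻ ω, volume (cell Φ m ω 0) ∂(palm P Φ)[|typicalTier J i] ≠ ∞ ∧
    ∀ g : Ω → ℝ≥0∞, Measurable g →
      ∫⁻ ω, g ω ∂P[|servedByTier Φ m J i] =
        (∫⁻ ω, (∫⁻ u in cell Φ m ω 0, g (u +ᵥ ω)) ∂(palm P Φ)[|typicalTier J i]) /
          ∫⁻ ω, volume (cell Φ m ω 0) ∂(palm P Φ)[|typicalTier J i] := by
  have hPalm : ∀ f : Ω → ℝ≥0∞, ∫⁻ ω, f ω ∂(palm P Φ)[|typicalTier J i] =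
      (palm P Φ (typicalTier J i))⁻¹ * ∫⁻ ω in typicalTier J i, f ω ∂(palm P Φ) := fun f => by
    rw [ProbabilityTheory.cond, lintegral_smul_measure, smul_eq_mul]
  have hvol : ∫⁻ ω in typicalTier J i, volume (cell Φ m ω 0) ∂(palm P Φ) =
      (intensity P Φ)⁻¹ * P (servedByTier Φ m J i) := by
    simpa using setLIntegral_typicalTier_palm P hΦ hm hJ i (g := fun _ => 1) measurable_const
  -- All nondegeneracy comes from here: a nonzero integral over the tier event forces that event to
  -- have positive Palm mass, which in turn forces `λ ≠ 0`.
  have hvol0 : ∫⁻ ω in typicalTier J i, volume (cell Φ m ω 0) ∂(palm P Φ) ≠ 0 := by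
    rw [hvol]
    exact mul_ne_zero (ENNReal.inv_ne_zero.2 hfin) hi
  have htyp0 : palm P Φ (typicalTier J i) ≠ 0 := fun h0 =>
    hvol0 (setLIntegral_measure_zero _ _ h0)
  have htop : palm P Φ (typicalTier J i) ≠ ∞ :=
    ((measure_mono (subset_univ _)).trans (palm_univ_le_one P hΦ)).trans_lt
      ENNReal.one_lt_top |>.ne
  have hlam0 : intensity P Φ ≠ 0 := intensity_ne_zero_of_palm_ne_zero P hΦ fun h0 =>
    htyp0 (measure_mono_null (subset_univ _) h0)
  have hc0 : (palm P Φ (typicalTier J i))⁻¹ * (intensity P Φ)⁻¹ ≠ 0 :=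
    mul_ne_zero (ENNReal.inv_ne_zero.2 htop) (ENNReal.inv_ne_zero.2 hfin)
  have hctop : (palm P Φ (typicalTier J i))⁻¹ * (intensity P Φ)⁻¹ ≠ ∞ :=
    ENNReal.mul_ne_top (ENNReal.inv_ne_top.2 htyp0) (ENNReal.inv_ne_top.2 hlam0)
  have hcell : ∫⁻ ω, volume (cell Φ m ω 0) ∂(palm P Φ)[|typicalTier J i] =
      (palm P Φ (typicalTier J i))⁻¹ * (intensity P Φ)⁻¹ * P (servedByTier Φ m J i) := by
    rw [hPalm, hvol, mul_assoc]
  rw [hcell]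
  refine ⟨htyp0, mul_ne_zero hc0 hi, ENNReal.mul_ne_top hctop (measure_ne_top _ _),
    fun g hg => ?_⟩
  rw [hPalm, setLIntegral_typicalTier_palm P hΦ hm hJ i hg, ← mul_assoc,
    ENNReal.mul_div_mul_left _ _ hc0 hctop, ProbabilityTheory.cond, lintegral_smul_measure,
    smul_eq_mul, mul_comm, div_eq_mul_inv]
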